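/- Let $d\ge 1$, let $\nu$ be a fixed probability measure on $\mathbb R^d$ with $\int |x|\,\nu(dx)<\infty$, and let $\mathbf c=(c_0,\dots,c_d)\in(0,\infty)^{d+1}$ satisfy $\sum_{i=1}^d c_i<1$. Let $\Phi$ be a set of measurable functions $\varphi:\mathbb R^d\to\mathbb R$ with $\|\varphi\|_{L^2([0,1]^d)}=1$, let $n_s\ge 1$ be an integer and $C\ge 1$. Let $\mathcal M=\mathcal M^0_\Phi(\mathbf c,n_s,C)$ be the set of all measurable $m:\mathbb R^d\to\mathbb R$ such that $|m(x)|\le c_0+\sum_{i=1}^d c_i|x_i|$ for all $x\in\mathbb R^d$ and $$m(x)=\sum_{i=1}^{n_s}\theta_i\,\varphi_i(A_ix-b_i)$$ for some $\varphi_i\in\Phi$, invertible $A_i\in\mathbb R^{d\times d}$, $b_i\in\mathbb R^d$, $\theta_i\in\mathbb R$ with $\max\{|\det A_i|^{-1},|A_i|_\infty,|b_i|_\infty,|\theta_i|\}\le C$, where $|\cdot|_\infty$ is the maximum of the absolute values of the entries. For $m\in\mathcal M$ consider the Gaussian nonlinear AR($d$) model $$Y_t=m(Y_{t-1},\dots,Y_{t-d})+v_t,\qquad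 t=1,\dots,T,$$ where $(Y_0,Y_{-1},\dots,Y_{-d+1})\sim\nu$ is independent of the i.i.d. $N(0,1)$ variables $v_1,\dots,v_T$. Put $X_t=(Y_{t-1},\dots,Y_{t-d})$ and $f_0=m\mathbf 1_{[0,1]^d}$. An estimator $\hat f_T$ is a real-valued function of $(Y_{-d+1},\dots,Y_T)$ and $x\in\mathbb R^d$ that is jointly measurable in both; its risk is $$R(\hat f_T,f_0)=\mathrm E\Big[\frac1T\sum_{t=1}^T\big(\hat f_T(X_t^*)-f_0(X_t^*)\big)^2\Big]\in[0,\infty],$$ where $(X_t^*)_{t=1}^T$ is an independent copy of $(X_t)_{t=1}^T$, independent of the observations. Suppose that there is a $\varphi\in\Phi$ with $\operatorname{supp}(\varphi)\subset[0,1]^d$ and $\sup_{x\in[0,1]^d}|\varphi(x)|\le c_0$. Then $$\liminf_{T\to\infty}\;T\,\inf_{\hat f_T}\,\sup_{m\in\mathcal M}R(\hat f_T,f_0)>0,$$ where the infimum is over all estimators $\hat f_T$. -/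

import Mathlib

open MeasureTheory ProbabilityTheory Filter Matrix
open scoped ENNReal

noncomputable section

namespace NonlinearAR

/-- A stretch `(Y_{1-d}, …, Y_0, Y_1, …, Y_T)` of the time series.  The first component `x₀` holds
the initial values in the order `x₀ i = Y_{-i}`, i.e. `x₀ = (Y_0, Y_{-1}, …, Y_{-d+1})`; the second
component `y` holds `y t = Y_{t+1}` for `t = 0, …, T-1`. -/
abbrev Sample (d T : ℕ) : Type := (Fin d → ℝ) × (Fin T → ℝ)

/-- The regressor `X_{t+1} = (Y_t, Y_{t-1}, …, Y_{t+1-d})`: its `i`-th entry is `Y_{t-i}`, which is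
`y (t-1-i)` if `i < t` and the initial value `x₀ (i-t)` otherwise. -/
def lag {d T : ℕ} (z : Sample d T) (t : Fin T) : Fin d → ℝ := fun i =>
  if _h : i.val < t.val then z.2 ⟨t.val - 1 - i.val, by have := t.isLt; omega⟩
  else z.1 ⟨i.val - t.val, by have := i.isLt; omega⟩

/-- The solution `Y_{t+1}`, `t = 0, …, T-1`, of the recursion `Y_{t+1} = m(Y_t, …, Y_{t+1-d}) + v_{t+1}`
with initial values `x₀` and noise `v` (where `v t` stands for `v_{t+1}`); see `path_eq`. -/
def path {d T : ℕ} (m : (Fin d → ℝ) → ℝ) (x₀ : Fin d → ℝ) (v : Fin T → ℝ) (t : Fin T) : ℝ :=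
  m (fun i : Fin d =>
    if _h : i.val < t.val then path m x₀ v ⟨t.val - 1 - i.val, by have := t.isLt; omega⟩
    else x₀ ⟨i.val - t.val, by have := i.isLt; omega⟩) + v t
termination_by t.val
decreasing_by omega

/-- The defining equation `Y_t = m(X_t) + v_t` of the autoregression. -/
theorem path_eq {d T : ℕ} (m : (Fin d → ℝ) → ℝ) (x₀ : Fin d → ℝ) (v : Fin T → ℝ) (t : Fin T) :
    path m x₀ v t = m (lag (x₀, path m x₀ v) t) + v t := by
  rw [path]
  rfl

/-- The law `P_{m,T}` of `(Y_{1-d}, …, Y_T)` when the initial vector has law `ν` and is independent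
of the i.i.d. standard normal noise `v_1, …, v_T`. -/
def law {d : ℕ} (ν : Measure (Fin d → ℝ)) (m : (Fin d → ℝ) → ℝ) (T : ℕ) : Measure (Sample d T) :=
  (ν.prod (Measure.pi fun _ : Fin T => gaussianReal 0 1)).map fun ω => (ω.1, path m ω.1 ω.2)

/-- The unit cube `[0,1]^d`. -/
def cube (d : ℕ) : Set (Fin d → ℝ) := Set.Icc 0 1

/-- The target `f₀ = m 1_{[0,1]^d}`. -/
def target {d : ℕ} (m : (Fin d → ℝ) → ℝ) : (Fin d → ℝ) → ℝ := (cube d).indicator m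

/-- An estimator of a function on `ℝ^d`, based on the observed stretch of the time series: jointly
measurable in the observations and in the argument of the function. -/
def IsEstimator {d T : ℕ} (f : Sample d T → (Fin d → ℝ) → ℝ) : Prop :=
  Measurable (Function.uncurry f)

/-- The generalization error `R(f̂, f₀) = E[T⁻¹ ∑_{t=1}^T (f̂(X*_t) - f₀(X*_t))²]`, where the
estimator is computed from `p.1` and `X*` from the independent copy `p.2`. -/
def risk {d : ℕ} (ν : Measure (Fin d → ℝ)) (m : (Fin d → ℝ) → ℝ) {T : ℕ}
    (f : Sample d T → (Fin d → ℝ) → ℝ) : ℝ≥0∞ :=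
  ∫⁻ p, (T : ℝ≥0∞)⁻¹ *
    ∑ t : Fin T, ENNReal.ofReal ((f p.1 (lag p.2 t) - target m (lag p.2 t)) ^ 2)
    ∂((law ν m T).prod (law ν m T))

/-- The minimax risk `inf_{f̂} sup_{m ∈ M} R(f̂, f₀)` for samples of length `T`. -/
def minimaxRisk {d : ℕ} (ν : Measure (Fin d → ℝ)) (M : Set ((Fin d → ℝ) → ℝ)) (T : ℕ) : ℝ≥0∞ :=
  ⨅ (f : Sample d T → (Fin d → ℝ) → ℝ) (_ : IsEstimator f), ⨆ m ∈ M, risk ν m f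

/-- The class `M₀(c)`: measurable `m` with `|m(x)| ≤ c₀ + ∑_{i=1}^d c_i |x_i|`. -/
def growthClass {d : ℕ} (c : Fin (d + 1) → ℝ) : Set ((Fin d → ℝ) → ℝ) :=
  {m | Measurable m ∧ ∀ x, |m x| ≤ c 0 + ∑ i : Fin d, c i.succ * |x i|}

/-- The `ℓ⁰`-bounded affine class: sums of `n` terms `θ_i φ_i(A_i x - b_i)` with `φ_i ∈ Φ` and
`|det A_i|⁻¹ ∨ |A_i|_∞ ∨ |b_i|_∞ ∨ |θ_i| ≤ C` (entrywise maximum norms); a singular `A_i` is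
excluded. -/
def affineClass {d : ℕ} (Φ : Set ((Fin d → ℝ) → ℝ)) (n : ℕ) (C : ℝ) : Set ((Fin d → ℝ) → ℝ) :=
  {m | ∃ (A : Fin n → Matrix (Fin d) (Fin d) ℝ) (b : Fin n → Fin d → ℝ) (θ : Fin n → ℝ)
      (φ : Fin n → (Fin d → ℝ) → ℝ),
    (∀ i, φ i ∈ Φ ∧ (A i).det ≠ 0 ∧ |(A i).det|⁻¹ ≤ C ∧ (∀ j k, |A i j k| ≤ C) ∧
      (∀ j, |b i j| ≤ C) ∧ |θ i| ≤ C) ∧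
    m = fun x => ∑ i, θ i * φ i (A i *ᵥ x - b i)}

/-- The class `M⁰_Φ(c, n, C) = M₀(c) ∩ I⁰_Φ(n, C)`. -/
def modelClass {d : ℕ} (Φ : Set ((Fin d → ℝ) → ℝ)) (c : Fin (d + 1) → ℝ) (n : ℕ) (C : ℝ) :
    Set ((Fin d → ℝ) → ℝ) :=
  growthClass c ∩ affineClass Φ n C

end NonlinearAR

end

/-!
The lower bound comes from Le Cam's two-point method with the drifts `0` and `θφ`, where `θ` is of
order `T^{-1/2}`.

Under the drift `0` the observations `Y_1, …, Y_T` are i.i.d. standard normal and the likelihood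
ratio `L` of `θφ` has second moment at most `e`, because each of its `T` Gaussian factors
contributes at most `exp (θ² sup φ²)`. Integrating `4 l ≤ 4 min(1, l) + l²` therefore bounds the
overlap `∫ min(1, L)` of the two laws from below.

The risk dominates a squared `L²([0,1]^d)` error uniformly over bounded drifts: given the past, each
`Y_t` is normal with a bounded mean, so its law dominates a fixed multiple of Lebesgue measure on
`[0,1]`, and after `d` steps the law of the regressor dominates a multiple of Lebesgue measure on
the cube. An estimator cannot be `L²`-close to both `0` and `θφ`, which are `|θ|` apart, so the
larger of its two risks is at least of order `θ²`, that is `1/T`.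
-/

namespace NonlinearAR

section ProductMeasure

theorem measurable_snoc {n : ℕ} {α : Type*} [MeasurableSpace α] :
    Measurable fun p : (Fin n → α) × α => (Fin.snoc p.1 p.2 : Fin (n + 1) → α) := by
  refine measurable_pi_iff.2 fun i => ?_
  cases i using Fin.lastCases with
  | last => simpa only [Fin.snoc_last] using measurable_snd
  | cast i => simpa only [Fin.snoc_castSucc] using by fun_prop

theorem lintegral_pi_snoc {n : ℕ} {α : Type*} [MeasurableSpace α] (ρ : Measure α) [SigmaFinite ρ]
    {F : (Fin (n + 1) → α) → ℝ≥0∞} (hF : Measurable F) :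
    ∫⁻ y, F y ∂(Measure.pi fun _ => ρ)
      = ∫⁻ y, ∫⁻ w, F (Fin.snoc y w) ∂ρ ∂(Measure.pi fun _ : Fin n => ρ) := by
  rw [← (measurePreserving_piFinSuccAbove (fun _ => ρ) (Fin.last n)).symm.lintegral_comp hF,
    lintegral_prod_symm' (fun p => F _) (hF.comp (MeasurableEquiv.measurable _))]
  simp only [MeasurableEquiv.piFinSuccAbove_symm_apply, Fin.insertNthEquiv_last]
  rfl

theorem lintegral_pi_comp_rev {n : ℕ} {α : Type*} [MeasurableSpace α] (ρ : Measure α)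
    [SigmaFinite ρ] {F : (Fin n → α) → ℝ≥0∞} (hF : Measurable F) :
    ∫⁻ y, F (y ∘ Fin.rev) ∂(Measure.pi fun _ => ρ) = ∫⁻ y, F y ∂(Measure.pi fun _ => ρ) := by
  rw [← (measurePreserving_piCongrLeft (fun _ : Fin n => ρ) Fin.revPerm).lintegral_comp hF]
  refine lintegral_congr fun y => congrArg F (funext fun i => ?_)
  obtain ⟨j, rfl⟩ := Fin.revPerm.surjective i
  rw [MeasurableEquiv.coe_piCongrLeft, Equiv.piCongrLeft_apply_apply]
  simp

theorem pi_restrict_unitInterval (d : ℕ) :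
    (Measure.pi fun _ : Fin d => (volume : Measure ℝ).restrict (Set.Icc 0 1))
      = volume.restrict (cube d) := by
  rw [← Measure.restrict_pi_pi, cube, ← Set.pi_univ_Icc]
  rfl

end ProductMeasure

section Gaussian

/-- The density `exp (a w - a² / 2)` of `N(a, 1)` with respect to `N(0, 1)`. -/
noncomputable def gaussianDensityRatio (a w : ℝ) : ℝ≥0∞ :=
  ENNReal.ofReal (Real.exp (a * w - a ^ 2 / 2))

theorem measurable_uncurry_gaussianDensityRatio :
    Measurable (Function.uncurry gaussianDensityRatio) := by
  unfold gaussianDensityRatio Function.uncurry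
  fun_prop

theorem measurable_gaussianDensityRatio (a : ℝ) : Measurable (gaussianDensityRatio a) :=
  measurable_uncurry_gaussianDensityRatio.of_uncurry_left

theorem gaussianPDF_eq_mul_gaussianDensityRatio (a w : ℝ) :
    gaussianPDF a 1 w = gaussianPDF 0 1 w * gaussianDensityRatio a w := by
  rw [gaussianPDF, gaussianPDF, gaussianDensityRatio,
    ← ENNReal.ofReal_mul (gaussianPDFReal_nonneg _ _ _), gaussianPDFReal, gaussianPDFReal,
    mul_assoc (√_)⁻¹, ← Real.exp_add]
  congr 3
  simp only [NNReal.coe_one]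
  ring

theorem gaussianReal_eq_withDensity (a : ℝ) :
    gaussianReal a 1 = (gaussianReal 0 1).withDensity (gaussianDensityRatio a) := by
  rw [gaussianReal_of_var_ne_zero _ one_ne_zero, gaussianReal_of_var_ne_zero _ one_ne_zero,
    ← withDensity_mul _ (measurable_gaussianPDF _ _)
      (measurable_gaussianDensityRatio a)]
  exact congrArg _ (funext (gaussianPDF_eq_mul_gaussianDensityRatio a))

theorem lintegral_gaussianReal_eq_lintegral_mul (a : ℝ) {f : ℝ → ℝ≥0∞} (hf : Measurable f) :
    ∫⁻ w, f w ∂(gaussianReal a 1)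
      = ∫⁻ w, gaussianDensityRatio a w * f w ∂(gaussianReal 0 1) := by
  rw [gaussianReal_eq_withDensity, lintegral_withDensity_eq_lintegral_mul _
    (measurable_gaussianDensityRatio a) hf]
  rfl

theorem lintegral_gaussianDensityRatio (a : ℝ) :
    ∫⁻ w, gaussianDensityRatio a w ∂(gaussianReal 0 1) = 1 := by
  simpa using (lintegral_gaussianReal_eq_lintegral_mul a (f := fun _ => 1) measurable_const).symm

theorem lintegral_gaussianDensityRatio_sq (a : ℝ) :
    ∫⁻ w, gaussianDensityRatio a w ^ 2 ∂(gaussianReal 0 1)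
      = ENNReal.ofReal (Real.exp (a ^ 2)) := by
  have sq_eq (w : ℝ) : gaussianDensityRatio a w ^ 2
      = ENNReal.ofReal (Real.exp (a ^ 2)) * gaussianDensityRatio (2 * a) w := by
    rw [gaussianDensityRatio, gaussianDensityRatio, ← ENNReal.ofReal_pow (Real.exp_nonneg _),
      ← Real.exp_nat_mul, ← ENNReal.ofReal_mul (Real.exp_nonneg _), ← Real.exp_add]
    congr 2
    push_cast
    ring
  simp_rw [sq_eq]
  rw [lintegral_const_mul _ (measurable_gaussianDensityRatio (2 * a)),
    lintegral_gaussianDensityRatio, mul_one]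

theorem measurable_lintegral_gaussianReal {Ω : Type*} [MeasurableSpace Ω] {a : Ω → ℝ}
    (ha : Measurable a) {F : Ω × ℝ → ℝ≥0∞} (hF : Measurable F) :
    Measurable fun ω => ∫⁻ w, F (ω, w) ∂(gaussianReal (a ω) 1) := by
  simp only [lintegral_gaussianReal_eq_lintegral_mul _
    (hF.of_uncurry_left (f := fun ω w => F (ω, w)))]
  exact Measurable.lintegral_prod_right' ((measurable_uncurry_gaussianDensityRatio.comp
    ((ha.comp measurable_fst).prodMk measurable_snd)).mul hF)

theorem gaussianPDF_smul_restrict_closedBall_le (a r : ℝ) {v : NNReal} (hv : v ≠ 0) :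
    gaussianPDF 0 v r • volume.restrict (Metric.closedBall a r) ≤ gaussianReal a v := by
  have pdf_le {w : ℝ} (hw : w ∈ Metric.closedBall a r) : gaussianPDF 0 v r ≤ gaussianPDF a v w := by
    have hr : (w - a) ^ 2 ≤ r ^ 2 := by
      rw [Metric.mem_closedBall, Real.dist_eq, abs_le] at hw
      exact sq_le_sq' hw.1 hw.2
    rw [gaussianPDF, gaussianPDF, gaussianPDFReal, gaussianPDFReal, sub_zero]
    gcongr
  rw [gaussianReal_of_var_ne_zero _ hv, ← withDensity_const]
  refine Measure.le_iff.2 fun s hs => ?_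
  rw [withDensity_apply _ hs, withDensity_apply _ hs, Measure.restrict_restrict hs]
  exact (setLIntegral_mono' (hs.inter Metric.isClosed_closedBall.measurableSet)
    fun w hw => pdf_le hw.2).trans (lintegral_mono_set Set.inter_subset_left)

theorem gaussianPDF_smul_restrict_unitInterval_le {a B : ℝ} (ha : |a| ≤ B) :
    gaussianPDF 0 1 (B + 1) • volume.restrict (Set.Icc 0 1) ≤ gaussianReal a 1 := by
  have subset_closedBall : Set.Icc (0 : ℝ) 1 ⊆ Metric.closedBall a (B + 1) := by
    rw [Real.closedBall_eq_Icc]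
    exact Set.Icc_subset_Icc (by linarith [le_abs_self a]) (by linarith [neg_abs_le a])
  refine le_trans ?_ (gaussianPDF_smul_restrict_closedBall_le a (B + 1) one_ne_zero)
  gcongr

end Gaussian

section Testing

theorem four_mul_le_four_mul_min_one_add_sq (l : ℝ≥0∞) : 4 * l ≤ 4 * min 1 l + l ^ 2 := by
  rcases le_total l 1 with hl | hl
  · rw [min_eq_right hl]
    exact le_self_add
  rw [min_eq_left hl]
  induction l using ENNReal.recTopCoe with
  | top => simp
  | coe l =>
    have am_gm : 4 * l ≤ 4 * 1 + l ^ 2 := by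
      rw [← NNReal.coe_le_coe]
      push_cast
      linarith [sq_nonneg ((l : ℝ) - 2)]
    exact_mod_cast am_gm

variable {Ω : Type*} [MeasurableSpace Ω] {P : Measure Ω} {L : Ω → ℝ≥0∞}

theorem one_le_four_mul_lintegral_min_one (hL : Measurable L) (hL1 : ∫⁻ ω, L ω ∂P = 1)
    (hL2 : ∫⁻ ω, L ω ^ 2 ∂P ≤ 3) : 1 ≤ 4 * ∫⁻ ω, min 1 (L ω) ∂P := by
  have hmin : Measurable fun ω => min 1 (L ω) := measurable_const.min hL
  refine (ENNReal.add_le_add_iff_right (a := 3) ENNReal.ofNat_ne_top).1 ?_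
  calc (1 + 3 : ℝ≥0∞) = 4 * ∫⁻ ω, L ω ∂P := by rw [hL1]; norm_num
    _ = ∫⁻ ω, 4 * L ω ∂P := (lintegral_const_mul _ hL).symm
    _ ≤ ∫⁻ ω, 4 * min 1 (L ω) + L ω ^ 2 ∂P :=
        lintegral_mono fun ω => four_mul_le_four_mul_min_one_add_sq (L ω)
    _ = 4 * ∫⁻ ω, min 1 (L ω) ∂P + ∫⁻ ω, L ω ^ 2 ∂P := by
        rw [lintegral_add_left (hmin.const_mul _), lintegral_const_mul _ hmin]
    _ ≤ 4 * ∫⁻ ω, min 1 (L ω) ∂P + 3 := by gcongr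

theorem le_four_mul_lintegral_add_lintegral_mul (hL : Measurable L) (hL1 : ∫⁻ ω, L ω ∂P = 1)
    (hL2 : ∫⁻ ω, L ω ^ 2 ∂P ≤ 3) {e₀ e₁ : Ω → ℝ≥0∞} (he₀ : Measurable e₀) {δ : ℝ≥0∞}
    (he : ∀ ω, δ ≤ e₀ ω + e₁ ω) :
    δ ≤ 4 * (∫⁻ ω, e₀ ω ∂P + ∫⁻ ω, L ω * e₁ ω ∂P) := by
  calc δ ≤ δ * (4 * ∫⁻ ω, min 1 (L ω) ∂P) :=
        le_mul_of_one_le_right' (one_le_four_mul_lintegral_min_one hL hL1 hL2)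
    _ = 4 * ∫⁻ ω, δ * min 1 (L ω) ∂P := by
        rw [lintegral_const_mul _ (measurable_const.min hL), mul_left_comm]
    _ ≤ 4 * ∫⁻ ω, e₀ ω + L ω * e₁ ω ∂P := by
        gcongr with ω
        calc δ * min 1 (L ω) ≤ (e₀ ω + e₁ ω) * min 1 (L ω) := by gcongr; exact he ω
          _ = e₀ ω * min 1 (L ω) + min 1 (L ω) * e₁ ω := by ring
          _ ≤ e₀ ω + L ω * e₁ ω := by
              gcongr
              · exact mul_le_of_le_one_right' (min_le_left _ _)
              · exact min_le_right _ _
    _ = _ := by rw [lintegral_add_left he₀]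

end Testing

section Autoregression

variable {d T : ℕ} {m : (Fin d → ℝ) → ℝ}

section Path

theorem measurable_lag (t : Fin T) : Measurable fun z : Sample d T => lag z t := by
  refine measurable_pi_iff.2 fun i => ?_
  unfold lag
  split_ifs <;> fun_prop

theorem lag_congr {x : Fin d → ℝ} {y y' : Fin T → ℝ} {t : Fin T} (h : ∀ s < t, y s = y' s) :
    lag (x, y) t = lag (x, y') t := by
  funext i
  unfold lag
  split_ifs with hi
  · exact h _ (Fin.lt_def.2 (by dsimp only; omega))
  · rfl

/-- The regressor `X_{T+1} = (Y_T, …, Y_{T+1-d})` that follows a stretch `(Y_{1-d}, …, Y_T)`. -/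
def nextLag (z : Sample d T) : Fin d → ℝ := fun i =>
  if _h : i.val < T then z.2 ⟨T - 1 - i.val, by omega⟩ else z.1 ⟨i.val - T, by omega⟩

theorem measurable_nextLag : Measurable (nextLag : Sample d T → Fin d → ℝ) := by
  refine measurable_pi_iff.2 fun i => ?_
  unfold nextLag
  split_ifs <;> fun_prop

theorem lag_snoc_castSucc (x : Fin d → ℝ) (y : Fin T → ℝ) (w : ℝ) (t : Fin T) :
    lag (x, Fin.snoc y w) t.castSucc = lag (x, y) t := by
  funext i
  unfold lag
  simp only [Fin.val_castSucc]
  split_ifs with hi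
  · exact Fin.snoc_castSucc (α := fun _ => ℝ) w y ⟨t.val - 1 - i.val, by omega⟩
  · rfl

theorem lag_snoc_last (x : Fin d → ℝ) (y : Fin T → ℝ) (w : ℝ) :
    lag (x, Fin.snoc y w) (Fin.last T) = nextLag (x, y) := by
  funext i
  unfold lag nextLag
  simp only [Fin.val_last]
  split_ifs with hi
  · exact Fin.snoc_castSucc (α := fun _ => ℝ) w y ⟨T - 1 - i.val, by omega⟩
  · rfl

theorem nextLag_append (x : Fin d → ℝ) (y : Fin T → ℝ) (u : Fin d → ℝ) :
    nextLag (x, Fin.append y u) = u ∘ Fin.rev := by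
  funext i
  have hi : (⟨T + d - 1 - i.val, by omega⟩ : Fin (T + d)) = Fin.natAdd T i.rev := by
    ext
    simp only [Fin.val_natAdd, Fin.val_rev]
    omega
  simp only [nextLag, dif_pos (show i.val < T + d by omega), hi, Fin.append_right,
    Function.comp_apply]

theorem eq_path {x : Fin d → ℝ} {v y : Fin T → ℝ} (h : ∀ t, y t = m (lag (x, y) t) + v t) :
    y = path m x v := by
  have agree (t : Fin T) : y t = path m x v t := by
    induction t using WellFoundedLT.induction with
    | ind t ih => rw [h, path_eq, lag_congr ih]
  exact funext agree

theorem path_snoc (x : Fin d → ℝ) (v : Fin T → ℝ) (w : ℝ) :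
    path m x (Fin.snoc v w : Fin (T + 1) → ℝ)
      = Fin.snoc (path m x v) (m (nextLag (x, path m x v)) + w) := by
  refine (eq_path fun t => ?_).symm
  cases t using Fin.lastCases with
  | last => rw [lag_snoc_last, Fin.snoc_last, Fin.snoc_last]
  | cast t => rw [lag_snoc_castSucc, Fin.snoc_castSucc, Fin.snoc_castSucc, path_eq]

theorem measurable_path (hm : Measurable m) :
    Measurable fun ω : Sample d T => path m ω.1 ω.2 := by
  induction T with
  | zero => exact measurable_of_subsingleton_codomain _
  | succ T ih =>
    have path_eq_snoc (ω : Sample d (T + 1)) : path m ω.1 ω.2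
        = Fin.snoc (path m ω.1 (Fin.init ω.2))
          (m (nextLag (ω.1, path m ω.1 (Fin.init ω.2))) + ω.2 (Fin.last T)) := by
      rw [← path_snoc, Fin.snoc_init_self]
    have measurable_init : Measurable fun ω : Sample d (T + 1) =>
        path m ω.1 (Fin.init ω.2) :=
      ih.comp (g := fun ω : Sample d T => path m ω.1 ω.2)
        (f := fun ω : Sample d (T + 1) => ((ω.1, Fin.init ω.2) : Sample d T))
        (measurable_fst.prodMk (measurable_pi_iff.2 fun i => by unfold Fin.init; fun_prop))
    simp only [path_eq_snoc]
    exact measurable_snoc.comp (measurable_init.prodMk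
      ((hm.comp (measurable_nextLag.comp (measurable_fst.prodMk measurable_init))).add
        (by fun_prop)))

end Path

section Law

variable {ν : Measure (Fin d → ℝ)}

theorem measurable_comp_snoc {G : Sample d (T + 1) → ℝ≥0∞} (hG : Measurable G) :
    Measurable fun p : Sample d T × ℝ => G (p.1.1, Fin.snoc p.1.2 p.2) :=
  hG.comp ((by fun_prop : Measurable fun p : Sample d T × ℝ => p.1.1).prodMk
    (measurable_snoc.comp (by fun_prop : Measurable fun p : Sample d T × ℝ => (p.1.2, p.2))))

theorem measurable_comp_snoc_right {G : Sample d (T + 1) → ℝ≥0∞} (hG : Measurable G)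
    (z : Sample d T) : Measurable fun w => G (z.1, Fin.snoc z.2 w) :=
  (measurable_comp_snoc hG).comp (measurable_const.prodMk measurable_id)

theorem measurable_lintegral_gaussianReal_snoc (hm : Measurable m) {G : Sample d (T + 1) → ℝ≥0∞}
    (hG : Measurable G) :
    Measurable fun z : Sample d T =>
      ∫⁻ w, G (z.1, Fin.snoc z.2 w) ∂(gaussianReal (m (nextLag z)) 1) :=
  measurable_lintegral_gaussianReal (hm.comp measurable_nextLag) (measurable_comp_snoc hG)

theorem lintegral_law (hm : Measurable m) {G : Sample d T → ℝ≥0∞} (hG : Measurable G) :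
    ∫⁻ z, G z ∂law ν m T
      = ∫⁻ x, ∫⁻ v, G (x, path m x v) ∂(Measure.pi fun _ => gaussianReal 0 1) ∂ν := by
  have measurable_sample : Measurable fun ω : Sample d T => ((ω.1, path m ω.1 ω.2) : Sample d T) :=
    measurable_fst.prodMk (measurable_path hm)
  rw [law, lintegral_map hG measurable_sample]
  exact lintegral_prod _ (hG.comp measurable_sample).aemeasurable

theorem isProbabilityMeasure_law [IsProbabilityMeasure ν] (hm : Measurable m) :
    IsProbabilityMeasure (law ν m T) :=
  Measure.isProbabilityMeasure_map (measurable_fst.prodMk (measurable_path hm)).aemeasurable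

theorem law_zero_length (m m' : (Fin d → ℝ) → ℝ) : law ν m 0 = law ν m' 0 :=
  congrArg (Measure.map · _) (funext fun _ => Prod.ext rfl (Subsingleton.elim _ _))

theorem lintegral_law_succ (hm : Measurable m) {G : Sample d (T + 1) → ℝ≥0∞} (hG : Measurable G) :
    ∫⁻ z, G z ∂law ν m (T + 1)
      = ∫⁻ z, ∫⁻ w, G (z.1, Fin.snoc z.2 w) ∂(gaussianReal (m (nextLag z)) 1) ∂law ν m T := by
  rw [lintegral_law hm hG, lintegral_law hm (measurable_lintegral_gaussianReal_snoc hm hG)]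
  refine lintegral_congr fun x => ?_
  rw [lintegral_pi_snoc _ ((hG.comp (measurable_fst.prodMk (measurable_path hm))).of_uncurry_left
    (f := fun x v => G (x, path m x v)))]
  refine lintegral_congr fun v => ?_
  have gaussianReal_eq_map (a : ℝ) : gaussianReal a 1 = (gaussianReal 0 1).map (a + ·) := by
    rw [gaussianReal_map_const_add, zero_add]
  rw [gaussianReal_eq_map (m _), lintegral_map (measurable_comp_snoc_right hG (x, path m x v))
    (measurable_const_add _)]
  simp only [path_snoc]

theorem lintegral_law_lag (hm : Measurable m) {h : (Fin d → ℝ) → ℝ≥0∞} (hh : Measurable h)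
    (t : Fin T) : ∫⁻ z, h (lag z t) ∂law ν m T = ∫⁻ z, h (nextLag z) ∂law ν m t := by
  induction T with
  | zero => exact t.elim0
  | succ T ih =>
    rw [lintegral_law_succ hm (G := fun z => h (lag z t)) (hh.comp (measurable_lag t))]
    cases t using Fin.lastCases with
    | last => simp only [lag_snoc_last, lintegral_const, measure_univ, mul_one, Fin.val_last]
    | cast t =>
      simp only [lag_snoc_castSucc, lintegral_const, measure_univ, mul_one, Fin.val_castSucc]
      exact ih t

end Law

section Likelihood

variable {ν : Measure (Fin d → ℝ)}

/-- The density of the law of `(Y_{1-d}, …, Y_T)` under the drift `m` with respect to its law under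
the drift `0`; see `lintegral_law_eq_lintegral_likelihoodRatio_mul`. -/
noncomputable def likelihoodRatio (m : (Fin d → ℝ) → ℝ) (z : Sample d T) : ℝ≥0∞ :=
  ∏ t, gaussianDensityRatio (m (lag z t)) (z.2 t)

theorem measurable_likelihoodRatio (hm : Measurable m) :
    Measurable (likelihoodRatio m : Sample d T → ℝ≥0∞) :=
  Finset.measurable_prod _ fun t _ => measurable_uncurry_gaussianDensityRatio.comp
    ((hm.comp (measurable_lag t)).prodMk (by fun_prop))

theorem likelihoodRatio_snoc (m : (Fin d → ℝ) → ℝ) (z : Sample d T) (w : ℝ) :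
    likelihoodRatio m ((z.1, Fin.snoc z.2 w) : Sample d (T + 1))
      = likelihoodRatio m z * gaussianDensityRatio (m (nextLag z)) w := by
  simp only [likelihoodRatio, Fin.prod_univ_castSucc, lag_snoc_castSucc, lag_snoc_last,
    Fin.snoc_castSucc, Fin.snoc_last]

theorem lintegral_law_eq_lintegral_likelihoodRatio_mul (hm : Measurable m)
    {G : Sample d T → ℝ≥0∞} (hG : Measurable G) :
    ∫⁻ z, G z ∂law ν m T = ∫⁻ z, likelihoodRatio m z * G z ∂law ν 0 T := by
  induction T with
  | zero =>
    simp only [likelihoodRatio, Finset.univ_eq_empty, Finset.prod_empty, one_mul,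
      law_zero_length m 0]
  | succ T ih =>
    rw [lintegral_law_succ hm hG, ih (measurable_lintegral_gaussianReal_snoc hm hG),
      lintegral_law_succ measurable_zero (G := fun z => likelihoodRatio m z * G z)
        ((measurable_likelihoodRatio hm).mul hG)]
    refine lintegral_congr fun z => ?_
    have hGz := measurable_comp_snoc_right hG z
    simp only [lintegral_gaussianReal_eq_lintegral_mul _ hGz, Pi.zero_apply, likelihoodRatio_snoc,
      mul_assoc]
    exact (lintegral_const_mul _ ((measurable_gaussianDensityRatio _).mul hGz)).symm

theorem lintegral_likelihoodRatio [IsProbabilityMeasure ν] (hm : Measurable m) :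
    ∫⁻ z, likelihoodRatio m z ∂law ν 0 T = 1 := by
  have := isProbabilityMeasure_law (ν := ν) (T := T) hm
  simpa using (lintegral_law_eq_lintegral_likelihoodRatio_mul (ν := ν) (T := T) (G := 1) hm
    measurable_one).symm

theorem lintegral_likelihoodRatio_sq_le [IsProbabilityMeasure ν] (hm : Measurable m) {b : ℝ}
    (hmb : ∀ x, m x ^ 2 ≤ b) :
    ∫⁻ z, likelihoodRatio m z ^ 2 ∂law ν 0 T ≤ ENNReal.ofReal (Real.exp (T * b)) := by
  induction T with
  | zero =>
    have := isProbabilityMeasure_law (ν := ν) (T := 0) (m := 0) measurable_zero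
    simp [likelihoodRatio]
  | succ T ih =>
    rw [lintegral_law_succ measurable_zero ((measurable_likelihoodRatio hm).pow_const 2)]
    calc ∫⁻ z, ∫⁻ w, likelihoodRatio m ((z.1, Fin.snoc z.2 w) : Sample d (T + 1)) ^ 2
          ∂(gaussianReal 0 1) ∂law ν 0 T
        = ∫⁻ z, likelihoodRatio m z ^ 2 * ENNReal.ofReal (Real.exp (m (nextLag z) ^ 2))
          ∂law ν 0 T := lintegral_congr fun z => by
          simp only [likelihoodRatio_snoc, mul_pow]
          rw [lintegral_const_mul _ ((measurable_gaussianDensityRatio _).pow_const 2),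
            lintegral_gaussianDensityRatio_sq]
      _ ≤ ∫⁻ z, likelihoodRatio m z ^ 2 * ENNReal.ofReal (Real.exp b) ∂law ν 0 T := by
          gcongr
          exact hmb _
      _ = (∫⁻ z, likelihoodRatio m z ^ 2 ∂law ν 0 T) * ENNReal.ofReal (Real.exp b) :=
          lintegral_mul_const _ ((measurable_likelihoodRatio hm).pow_const 2)
      _ ≤ ENNReal.ofReal (Real.exp (T * b)) * ENNReal.ofReal (Real.exp b) := by gcongr
      _ = ENNReal.ofReal (Real.exp ((T + 1 : ℕ) * b)) := by
          rw [← ENNReal.ofReal_mul (Real.exp_nonneg _), ← Real.exp_add]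
          push_cast
          ring_nf

end Likelihood

section Minorization

theorem measurable_append {k : ℕ} {α : Type*} [MeasurableSpace α] (y : Fin T → α) :
    Measurable (Fin.append y : (Fin k → α) → Fin (T + k) → α) := by
  refine measurable_pi_iff.2 fun i => ?_
  cases i using Fin.addCases with
  | left i => simpa only [Fin.append_left] using measurable_const
  | right i => simpa only [Fin.append_right] using measurable_pi_apply i

variable {ν : Measure (Fin d → ℝ)} {ρ : Measure ℝ} [SigmaFinite ρ] {κ : ℝ≥0∞}

theorem pow_mul_lintegral_append_le (hm : Measurable m)
    (hρ : ∀ x, κ • ρ ≤ gaussianReal (m x) 1) (k : ℕ) {G : Sample d (T + k) → ℝ≥0∞}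
    (hG : Measurable G) :
    κ ^ k * ∫⁻ z, ∫⁻ u, G (z.1, Fin.append z.2 u) ∂(Measure.pi fun _ => ρ) ∂law ν m T
      ≤ ∫⁻ z, G z ∂law ν m (T + k) := by
  induction k with
  | zero => simp [Fin.append_right_nil]
  | succ k ih =>
    have hGρ : Measurable fun z : Sample d (T + k) => ∫⁻ w, G (z.1, Fin.snoc z.2 w) ∂ρ :=
      Measurable.lintegral_prod_right' (measurable_comp_snoc hG)
    have append_eq_snoc (z : Sample d T) :
        ∫⁻ u, G (z.1, Fin.append z.2 u) ∂(Measure.pi fun _ : Fin (k + 1) => ρ)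
          = ∫⁻ u, ∫⁻ w, G (z.1, Fin.snoc (Fin.append z.2 u) w) ∂ρ ∂(Measure.pi fun _ => ρ) := by
      rw [lintegral_pi_snoc ρ (F := fun u => G (z.1, Fin.append z.2 u))
        (hG.comp (measurable_const.prodMk (measurable_append z.2)))]
      simp only [Fin.append_snoc]
    simp only [append_eq_snoc]
    calc κ ^ (k + 1) * ∫⁻ z, ∫⁻ u, ∫⁻ w, G (z.1, Fin.snoc (Fin.append z.2 u) w) ∂ρ
            ∂(Measure.pi fun _ => ρ) ∂law ν m T
        ≤ κ * ∫⁻ z, ∫⁻ w, G (z.1, Fin.snoc z.2 w) ∂ρ ∂law ν m (T + k) := by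
          rw [pow_succ', mul_assoc]
          gcongr
          exact ih hGρ
      _ = ∫⁻ z, κ * ∫⁻ w, G (z.1, Fin.snoc z.2 w) ∂ρ ∂law ν m (T + k) :=
          (lintegral_const_mul _ hGρ).symm
      _ ≤ ∫⁻ z, ∫⁻ w, G (z.1, Fin.snoc z.2 w) ∂(gaussianReal (m (nextLag z)) 1)
            ∂law ν m (T + k) := by
          refine lintegral_mono fun z => ?_
          rw [← smul_eq_mul, ← lintegral_smul_measure]
          exact lintegral_mono' (hρ _) le_rfl
      _ = ∫⁻ z, G z ∂law ν m (T + (k + 1)) := (lintegral_law_succ hm hG).symm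

theorem pow_mul_lintegral_le_lintegral_lag [IsProbabilityMeasure ν] (hm : Measurable m)
    (hρ : ∀ x, κ • ρ ≤ gaussianReal (m x) 1) {h : (Fin d → ℝ) → ℝ≥0∞} (hh : Measurable h)
    {t : Fin T} (ht : d ≤ t) :
    κ ^ d * ∫⁻ u, h u ∂(Measure.pi fun _ => ρ) ≤ ∫⁻ z, h (lag z t) ∂law ν m T := by
  obtain ⟨s, hs⟩ := Nat.exists_eq_add_of_le' ht
  have := isProbabilityMeasure_law (ν := ν) (T := s) hm
  rw [lintegral_law_lag hm hh, hs]
  refine le_of_eq_of_le ?_ (pow_mul_lintegral_append_le hm hρ d (hh.comp measurable_nextLag))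
  simp only [nextLag_append, lintegral_pi_comp_rev ρ hh, lintegral_const,
    measure_univ, mul_one]

end Minorization

end Autoregression

section Risk

variable {d T : ℕ} {m : (Fin d → ℝ) → ℝ} {f : Sample d T → (Fin d → ℝ) → ℝ}

/-- The squared `L²([0,1]^d)` distance of two functions. -/
noncomputable def cubeSqDist (g m : (Fin d → ℝ) → ℝ) : ℝ≥0∞ :=
  ∫⁻ x in cube d, ENNReal.ofReal ((g x - m x) ^ 2)

theorem measurableSet_cube : MeasurableSet (cube d) := measurableSet_Icc

theorem measurable_cubeSqDist (hf : IsEstimator f) (hm : Measurable m) :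
    Measurable fun p => cubeSqDist (f p) m :=
  Measurable.lintegral_prod_right'
    (f := fun q : Sample d T × (Fin d → ℝ) => ENNReal.ofReal ((f q.1 q.2 - m q.2) ^ 2))
    ((Measurable.sub hf (hm.comp measurable_snd)).pow_const 2).ennreal_ofReal

theorem cubeSqDist_target (g m : (Fin d → ℝ) → ℝ) : cubeSqDist g (target m) = cubeSqDist g m :=
  setLIntegral_congr_fun measurableSet_cube fun x hx => by
    simp only [target, Set.indicator_of_mem hx]

theorem cubeSqDist_le_two_mul_add {g : (Fin d → ℝ) → ℝ} (hg : Measurable g)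
    {m₀ : (Fin d → ℝ) → ℝ} (hm₀ : Measurable m₀) (m₁ : (Fin d → ℝ) → ℝ) :
    cubeSqDist m₀ m₁ ≤ 2 * (cubeSqDist g m₀ + cubeSqDist g m₁) := by
  have hgm₀ : Measurable fun x => ENNReal.ofReal ((g x - m₀ x) ^ 2) :=
    ((hg.sub hm₀).pow_const 2).ennreal_ofReal
  rw [cubeSqDist, cubeSqDist, cubeSqDist, ← lintegral_add_left hgm₀,
    ← lintegral_const_mul' _ _ ENNReal.ofNat_ne_top]
  refine lintegral_mono fun x => ?_
  rw [← ENNReal.ofReal_add (sq_nonneg _) (sq_nonneg _), ← ENNReal.ofReal_ofNat,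
    ← ENNReal.ofReal_mul zero_le_two]
  exact ENNReal.ofReal_le_ofReal (by linarith [sq_nonneg (g x - m₀ x + (g x - m₁ x))])

theorem cubeSqDist_zero_smul (θ : ℝ) (φ : (Fin d → ℝ) → ℝ) :
    cubeSqDist 0 (θ • φ) = ENNReal.ofReal (θ ^ 2) * cubeSqDist 0 φ := by
  simp only [cubeSqDist, Pi.zero_apply, Pi.smul_apply, smul_eq_mul, zero_sub, neg_sq, mul_pow,
    ENNReal.ofReal_mul (sq_nonneg θ)]
  exact lintegral_const_mul' _ _ ENNReal.ofReal_ne_top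

theorem cubeSqDist_zero_left (φ : (Fin d → ℝ) → ℝ) :
    cubeSqDist 0 φ = eLpNorm φ 2 (volume.restrict (cube d)) ^ 2 := by
  have eLpNorm_sq := eLpNorm_nnreal_pow_eq_lintegral (f := φ) (μ := volume.restrict (cube d))
    two_ne_zero
  simp only [ENNReal.coe_ofNat, NNReal.coe_ofNat, ENNReal.rpow_ofNat] at eLpNorm_sq
  rw [eLpNorm_sq]
  refine lintegral_congr fun x => ?_
  rw [Pi.zero_apply, zero_sub, neg_sq, ← sq_abs, ENNReal.ofReal_pow (abs_nonneg _),
    ← Real.enorm_eq_ofReal_abs]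

variable {ν : Measure (Fin d → ℝ)} [IsProbabilityMeasure ν]

theorem risk_eq_mul_lintegral_sum (hm : Measurable m) (hf : IsEstimator f) :
    risk ν m f = (T : ℝ≥0∞)⁻¹ * ∫⁻ p, ∑ t : Fin T, ∫⁻ q,
      ENNReal.ofReal ((f p (lag q t) - target m (lag q t)) ^ 2) ∂law ν m T ∂law ν m T := by
  have := isProbabilityMeasure_law (ν := ν) (T := T) hm
  have measurable_loss (t : Fin T) : Measurable fun p : Sample d T × Sample d T =>
      ENNReal.ofReal ((f p.1 (lag p.2 t) - target m (lag p.2 t)) ^ 2) := by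
    have measurable_lag_snd : Measurable fun p : Sample d T × Sample d T => lag p.2 t :=
      (measurable_lag t).comp measurable_snd
    exact (((hf.comp (measurable_fst.prodMk measurable_lag_snd)).sub
      ((hm.indicator measurableSet_cube).comp measurable_lag_snd)).pow_const 2).ennreal_ofReal
  have measurable_sum := Finset.univ.measurable_sum fun t _ => measurable_loss t
  rw [risk, lintegral_const_mul _ measurable_sum, lintegral_prod _ measurable_sum.aemeasurable]
  refine congrArg _ (lintegral_congr fun p => lintegral_finsetSum _ fun t _ => ?_)
  exact (measurable_loss t).comp (measurable_const.prodMk measurable_id)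

variable {κ : ℝ≥0∞}

theorem sub_mul_pow_mul_cubeSqDist_le_sum (hm : Measurable m)
    (hκ : ∀ x, κ • volume.restrict (Set.Icc 0 1) ≤ gaussianReal (m x) 1) {g : (Fin d → ℝ) → ℝ}
    (hg : Measurable g) :
    (T - d : ℕ) * (κ ^ d * cubeSqDist g m)
      ≤ ∑ t : Fin T, ∫⁻ q, ENNReal.ofReal ((g (lag q t) - target m (lag q t)) ^ 2)
        ∂law ν m T := by
  have card_late : (Finset.univ.filter fun t : Fin T => d ≤ t).card = T - d := by
    have := Finset.card_filter_add_card_filter_not (s := (Finset.univ : Finset (Fin T)))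
      (fun t => t.val < d)
    simp only [not_lt, Fin.card_filter_val_lt, Finset.card_univ, Fintype.card_fin] at this
    omega
  have measurable_loss : Measurable fun x => ENNReal.ofReal ((g x - target m x) ^ 2) :=
    ((hg.sub (hm.indicator measurableSet_cube)).pow_const 2).ennreal_ofReal
  calc (T - d : ℕ) * (κ ^ d * cubeSqDist g m)
      = ∑ t with d ≤ (t : Fin T).val, κ ^ d * cubeSqDist g (target m) := by
        rw [Finset.sum_const, card_late, nsmul_eq_mul, cubeSqDist_target]
    _ ≤ ∑ t with d ≤ (t : Fin T).val, ∫⁻ q,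
          ENNReal.ofReal ((g (lag q t) - target m (lag q t)) ^ 2) ∂law ν m T := by
        refine Finset.sum_le_sum fun t ht => ?_
        rw [cubeSqDist, ← pi_restrict_unitInterval]
        exact pow_mul_lintegral_le_lintegral_lag hm hκ measurable_loss (Finset.mem_filter.1 ht).2
    _ ≤ _ := Finset.sum_le_sum_of_subset (Finset.filter_subset _ _)

theorem pow_mul_lintegral_cubeSqDist_le_two_mul_risk (hm : Measurable m)
    (hκ : ∀ x, κ • volume.restrict (Set.Icc 0 1) ≤ gaussianReal (m x) 1) (hf : IsEstimator f)
    (hT : 0 < T) (hdT : 2 * d ≤ T) :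
    κ ^ d * ∫⁻ p, cubeSqDist (f p) m ∂law ν m T ≤ 2 * risk ν m f := by
  have half_le : 1 ≤ 2 * ((T : ℝ≥0∞)⁻¹ * (T - d : ℕ)) := by
    rw [mul_left_comm, ← ENNReal.inv_mul_cancel (Nat.cast_ne_zero.2 hT.ne')
      (ENNReal.natCast_ne_top T)]
    gcongr
    exact_mod_cast (by omega : T ≤ 2 * (T - d))
  calc κ ^ d * ∫⁻ p, cubeSqDist (f p) m ∂law ν m T
      ≤ 2 * ((T : ℝ≥0∞)⁻¹ * (T - d : ℕ)) * (κ ^ d * ∫⁻ p, cubeSqDist (f p) m ∂law ν m T) :=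
        le_mul_of_one_le_left' half_le
    _ = 2 * ((T : ℝ≥0∞)⁻¹ * ∫⁻ p, (T - d : ℕ) * (κ ^ d * cubeSqDist (f p) m) ∂law ν m T) := by
        have hdist := measurable_cubeSqDist hf hm
        rw [lintegral_const_mul _ (hdist.const_mul _), lintegral_const_mul _ hdist]
        simp only [mul_assoc]
    _ ≤ 2 * risk ν m f := by
        rw [risk_eq_mul_lintegral_sum hm hf]
        gcongr with p
        exact sub_mul_pow_mul_cubeSqDist_le_sum hm hκ hf.of_uncurry_left

end Risk

section TwoPoint

variable {d T : ℕ} {m : (Fin d → ℝ) → ℝ} {ν : Measure (Fin d → ℝ)} [IsProbabilityMeasure ν]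

theorem cubeSqDist_le_eight_mul_lintegral_add (hm : Measurable m)
    (hmT : ∀ x, T * m x ^ 2 ≤ 1) {f : Sample d T → (Fin d → ℝ) → ℝ} (hf : IsEstimator f)
    (hT : 0 < T) :
    cubeSqDist 0 m ≤ 8 * (∫⁻ p, cubeSqDist (f p) 0 ∂law ν 0 T
      + ∫⁻ p, cubeSqDist (f p) m ∂law ν m T) := by
  have hT' : (0 : ℝ) < T := Nat.cast_pos.2 hT
  have second_moment : ∫⁻ p, likelihoodRatio m p ^ 2 ∂law ν 0 T ≤ 3 := by
    refine (lintegral_likelihoodRatio_sq_le hm (b := (T : ℝ)⁻¹) fun x => ?_).trans ?_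
    · exact (le_inv_mul_iff₀ hT').2 (hmT x) |>.trans_eq (mul_one _)
    · rw [mul_inv_cancel₀ hT'.ne', ← ENNReal.ofReal_ofNat]
      exact ENNReal.ofReal_le_ofReal Real.exp_one_lt_three.le
  have hdist₀ := (measurable_cubeSqDist hf measurable_zero).const_mul 2
  have testing := le_four_mul_lintegral_add_lintegral_mul (measurable_likelihoodRatio hm)
    (lintegral_likelihoodRatio (ν := ν) hm) second_moment hdist₀ fun p =>
      (cubeSqDist_le_two_mul_add (hf.of_uncurry_left (x := p)) measurable_zero m).trans_eq
        (mul_add _ _ _)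
  simp only [mul_left_comm _ (2 : ℝ≥0∞)] at testing
  rw [lintegral_const_mul' _ _ ENNReal.ofNat_ne_top, lintegral_const_mul' _ _ ENNReal.ofNat_ne_top,
    ← mul_add, ← mul_assoc, ← lintegral_law_eq_lintegral_likelihoodRatio_mul hm
      (measurable_cubeSqDist hf hm)] at testing
  exact testing.trans_eq (by norm_num)

theorem pow_mul_cubeSqDist_le_sixteen_mul_risk_add_risk (hm : Measurable m)
    (hmT : ∀ x, T * m x ^ 2 ≤ 1) {f : Sample d T → (Fin d → ℝ) → ℝ} (hf : IsEstimator f)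
    (hT : 0 < T) (hdT : 2 * d ≤ T) :
    gaussianPDF 0 1 2 ^ d * cubeSqDist 0 m ≤ 16 * (risk ν 0 f + risk ν m f) := by
  have abs_drift_le (x) : |m x| ≤ 1 := by
    rw [← sq_le_one_iff_abs_le_one]
    exact (le_mul_of_one_le_left (sq_nonneg _) (Nat.one_le_cast.2 hT)).trans (hmT x)
  have minorization {a : ℝ} (ha : |a| ≤ 1) :
      gaussianPDF 0 1 2 • volume.restrict (Set.Icc 0 1) ≤ gaussianReal a 1 := by
    simpa only [one_add_one_eq_two] using gaussianPDF_smul_restrict_unitInterval_le ha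
  calc gaussianPDF 0 1 2 ^ d * cubeSqDist 0 m
      ≤ gaussianPDF 0 1 2 ^ d * (8 * (∫⁻ p, cubeSqDist (f p) 0 ∂law ν 0 T
          + ∫⁻ p, cubeSqDist (f p) m ∂law ν m T)) := by
        gcongr
        exact cubeSqDist_le_eight_mul_lintegral_add hm hmT hf hT
    _ = 8 * (gaussianPDF 0 1 2 ^ d * ∫⁻ p, cubeSqDist (f p) 0 ∂law ν 0 T
          + gaussianPDF 0 1 2 ^ d * ∫⁻ p, cubeSqDist (f p) m ∂law ν m T) := by ring
    _ ≤ 8 * (2 * risk ν 0 f + 2 * risk ν m f) := by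
        refine mul_le_mul' le_rfl (add_le_add ?_ ?_)
        · exact pow_mul_lintegral_cubeSqDist_le_two_mul_risk measurable_zero
            (fun _ => minorization (by simp)) hf hT hdT
        · exact pow_mul_lintegral_cubeSqDist_le_two_mul_risk hm
            (fun x => minorization (abs_drift_le x)) hf hT hdT
    _ = 16 * (risk ν 0 f + risk ν m f) := by ring

theorem pow_mul_cubeSqDist_le_mul_minimaxRisk {M : Set ((Fin d → ℝ) → ℝ)} (h0M : 0 ∈ M)
    (hmM : m ∈ M) (hm : Measurable m) (hmT : ∀ x, T * m x ^ 2 ≤ 1) (hT : 0 < T)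
    (hdT : 2 * d ≤ T) :
    gaussianPDF 0 1 2 ^ d * cubeSqDist 0 m ≤ 32 * minimaxRisk ν M T := by
  simp only [minimaxRisk, ENNReal.mul_iInf_of_ne (a := 32) (by norm_num) (by norm_num)]
  refine le_iInf₂ fun f hf => ?_
  calc gaussianPDF 0 1 2 ^ d * cubeSqDist 0 m
      ≤ 16 * (risk ν 0 f + risk ν m f) :=
        pow_mul_cubeSqDist_le_sixteen_mul_risk_add_risk hm hmT hf hT hdT
    _ ≤ 16 * ((⨆ m ∈ M, risk ν m f) + ⨆ m ∈ M, risk ν m f) := by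
        gcongr
        · exact le_iSup₂ (f := fun m _ => risk ν m f) 0 h0M
        · exact le_iSup₂ (f := fun m _ => risk ν m f) m hmM
    _ = 32 * ⨆ m ∈ M, risk ν m f := by ring

theorem mul_cubeSqDist_le_mul_mul_minimaxRisk {M : Set ((Fin d → ℝ) → ℝ)} {φ : (Fin d → ℝ) → ℝ}
    (hφ : Measurable φ) {B : ℝ} (hφB : ∀ x, |φ x| ≤ B) (hM : ∀ θ : ℝ, |θ| ≤ 1 → θ • φ ∈ M)
    (hT : 0 < T) (hdT : 2 * d ≤ T) :
    ENNReal.ofReal ((1 + B)⁻¹ ^ 2) * (gaussianPDF 0 1 2 ^ d * cubeSqDist 0 φ)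
      ≤ 32 * (T * minimaxRisk ν M T) := by
  have hT' : (1 : ℝ) ≤ T := Nat.one_le_cast.2 hT
  have hB : 0 ≤ B := (abs_nonneg _).trans (hφB 0)
  set θ : ℝ := (√T)⁻¹ * (1 + B)⁻¹ with θ_def
  have T_mul_θ_sq : T * θ ^ 2 = (1 + B)⁻¹ ^ 2 := by
    rw [θ_def, mul_pow, inv_pow, Real.sq_sqrt (by positivity), mul_inv_cancel_left₀ (by positivity)]
  have abs_θ_le : |θ| ≤ 1 := by
    rw [abs_of_nonneg (by positivity)]
    exact mul_le_one₀ (inv_le_one_of_one_le₀ (Real.one_le_sqrt.2 hT')) (by positivity)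
      (inv_le_one_of_one_le₀ (by linarith))
  have drift_sq_le (x) : T * (θ • φ) x ^ 2 ≤ 1 := by
    rw [Pi.smul_apply, smul_eq_mul, mul_pow, ← mul_assoc, T_mul_θ_sq, ← mul_pow,
      sq_le_one_iff_abs_le_one, abs_mul, abs_of_nonneg (by positivity),
      inv_mul_le_one₀ (by positivity)]
    linarith [hφB x]
  calc ENNReal.ofReal ((1 + B)⁻¹ ^ 2) * (gaussianPDF 0 1 2 ^ d * cubeSqDist 0 φ)
      = T * (gaussianPDF 0 1 2 ^ d * cubeSqDist 0 (θ • φ)) := by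
        rw [cubeSqDist_zero_smul, ← T_mul_θ_sq, ENNReal.ofReal_mul T.cast_nonneg,
          ENNReal.ofReal_natCast]
        ring
    _ ≤ T * (32 * minimaxRisk ν M T) := by
        refine mul_le_mul' le_rfl ?_
        exact pow_mul_cubeSqDist_le_mul_minimaxRisk (by simpa using hM 0 (by simp)) (hM θ abs_θ_le)
          (hφ.const_smul θ) drift_sq_le hT hdT
    _ = 32 * (T * minimaxRisk ν M T) := mul_left_comm _ _ _

theorem pos_liminf_mul_minimaxRisk {M : Set ((Fin d → ℝ) → ℝ)} {φ : (Fin d → ℝ) → ℝ}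
    (hφ : Measurable φ) {B : ℝ} (hφB : ∀ x, |φ x| ≤ B) (hφ0 : cubeSqDist 0 φ ≠ 0)
    (hM : ∀ θ : ℝ, |θ| ≤ 1 → θ • φ ∈ M) :
    0 < liminf (fun T : ℕ => (T : ℝ≥0∞) * minimaxRisk ν M T) atTop := by
  have hB : 0 < 1 + B := by linarith [(abs_nonneg _).trans (hφB 0)]
  set δ : ℝ≥0∞ := ENNReal.ofReal ((1 + B)⁻¹ ^ 2) * (gaussianPDF 0 1 2 ^ d * cubeSqDist 0 φ)
  have δ_ne_zero : δ ≠ 0 :=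
    mul_ne_zero (ENNReal.ofReal_pos.2 (by positivity)).ne'
      (mul_ne_zero (pow_ne_zero _ (gaussianPDF_pos _ one_ne_zero _).ne') hφ0)
  refine (ENNReal.div_pos δ_ne_zero (ENNReal.ofNat_ne_top (n := 32))).trans_le
    (le_liminf_of_le (by isBoundedDefault) ?_)
  filter_upwards [eventually_ge_atTop (2 * d), eventually_gt_atTop 0] with T hdT hT
  exact ENNReal.div_le_of_le_mul'
    (mul_cubeSqDist_le_mul_mul_minimaxRisk hφ hφB hM hT hdT)

end TwoPoint

section ModelClass

variable {d : ℕ} {φ : (Fin d → ℝ) → ℝ} {c : Fin (d + 1) → ℝ} {θ : ℝ}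

theorem smul_mem_growthClass (hφ : Measurable φ) (hc : ∀ i, 0 ≤ c i) (hφc : ∀ x, |φ x| ≤ c 0)
    (hθ : |θ| ≤ 1) : θ • φ ∈ growthClass c := by
  refine ⟨hφ.const_smul θ, fun x => ?_⟩
  calc |θ * φ x| ≤ 1 * c 0 := by rw [abs_mul]; gcongr; exact hφc x
    _ = c 0 := one_mul _
    _ ≤ c 0 + ∑ i : Fin d, c i.succ * |x i| :=
      le_add_of_nonneg_right (Finset.sum_nonneg fun i _ => mul_nonneg (hc _) (abs_nonneg _))

theorem smul_mem_affineClass {Φ : Set ((Fin d → ℝ) → ℝ)} (hφΦ : φ ∈ Φ) {n : ℕ} (hn : 1 ≤ n)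
    {C : ℝ} (hC : 1 ≤ C) (hθ : |θ| ≤ C) : θ • φ ∈ affineClass Φ n C := by
  have hC0 : 0 ≤ C := zero_le_one.trans hC
  refine ⟨fun _ => 1, fun _ => 0, Pi.single ⟨0, hn⟩ θ, fun _ => φ, fun i =>
    ⟨hφΦ, by simp, by simpa using hC, fun j k => ?_, fun _ => by simpa using hC0, ?_⟩, ?_⟩
  · simp only [Matrix.one_apply]
    split_ifs <;> simp [hC, hC0]
  · rw [Pi.single_apply]
    split_ifs <;> simp [hθ, hC0]
  · funext x
    simp [Pi.single_apply]

end ModelClass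

theorem abs_le_of_tsupport_subset {X : Type*} [TopologicalSpace X] {φ : X → ℝ} {s : Set X} {B : ℝ}
    (hB : 0 ≤ B) (hs : tsupport φ ⊆ s) (hφB : ∀ x ∈ s, |φ x| ≤ B) (x : X) : |φ x| ≤ B := by
  by_cases hx : x ∈ s
  · exact hφB x hx
  · rwa [image_eq_zero_of_notMem_tsupport fun h => hx (hs h), abs_zero]

end NonlinearAR

theorem mainTheorem5_general {d : ℕ} (ν : Measure (Fin d → ℝ)) [IsProbabilityMeasure ν]
    {c : Fin (d + 1) → ℝ} (hc : ∀ i, 0 ≤ c i) {Φ : Set ((Fin d → ℝ) → ℝ)} {n : ℕ} (hn : 1 ≤ n)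
    {C : ℝ} (hC : 1 ≤ C) {φ : (Fin d → ℝ) → ℝ} (hφΦ : φ ∈ Φ) (hφ : Measurable φ)
    (hφc : ∀ x, |φ x| ≤ c 0) (hφ0 : eLpNorm φ 2 (volume.restrict (NonlinearAR.cube d)) ≠ 0) :
    0 < liminf (fun T : ℕ =>
      (T : ℝ≥0∞) * NonlinearAR.minimaxRisk ν (NonlinearAR.modelClass Φ c n C) T) atTop := by
  refine NonlinearAR.pos_liminf_mul_minimaxRisk hφ hφc ?_ fun θ hθ =>
    ⟨NonlinearAR.smul_mem_growthClass hφ hc hφc hθ,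
      NonlinearAR.smul_mem_affineClass hφΦ hn hC (hθ.trans hC)⟩
  rw [NonlinearAR.cubeSqDist_zero_left]
  exact pow_ne_zero 2 hφ0

theorem mainTheorem5 (d : ℕ) (hd : 1 ≤ d)
    (ν : Measure (Fin d → ℝ)) [IsProbabilityMeasure ν]
    (hν : Integrable (fun x : Fin d → ℝ => ‖WithLp.toLp 2 x‖) ν)
    (c : Fin (d + 1) → ℝ) (hc : ∀ i, 0 < c i) (hc1 : ∑ i : Fin d, c i.succ < 1)
    (Φ : Set ((Fin d → ℝ) → ℝ))
    (hΦ : ∀ φ ∈ Φ, Measurable φ ∧ eLpNorm φ 2 (volume.restrict (NonlinearAR.cube d)) = 1)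
    (n : ℕ) (hn : 1 ≤ n) (C : ℝ) (hC : 1 ≤ C)
    (hφ : ∃ φ ∈ Φ, tsupport φ ⊆ NonlinearAR.cube d ∧ ∀ x ∈ NonlinearAR.cube d, |φ x| ≤ c 0) :
    0 < liminf (fun T : ℕ =>
      (T : ℝ≥0∞) * NonlinearAR.minimaxRisk ν (NonlinearAR.modelClass Φ c n C) T) atTop := by
  obtain ⟨φ, hφΦ, hsupp, hφc⟩ := hφ
  exact mainTheorem5_general ν (fun i => (hc i).le) hn hC hφΦ (hΦ φ hφΦ).1
    (NonlinearAR.abs_le_of_tsupport_subset (hc 0).le hsupp hφc) (by simp [(hΦ φ hφΦ).2])
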